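/- Let $\Phi(x,y)\in\mathbb{C}[x,y]$ be a symmetric polynomial of partial degree $d\ge 1$ (its degree in $y$, equivalently in $x$, is $d$). Assume that $\Phi$ is standard: it has no repeated factors, no nonconstant factor depending only on $x$ or only on $y$, and $\Phi(x,x)$ is not the zero polynomial. The digraph $G(\Phi)$ has vertex set $\mathbb{C}$, and the number of arcs from $u$ to $v$ is the multiplicity of $v$ as a root of $\Phi(u,y)$. A vertex $u$ is defective if $a_d(u)=0$, where $a_d(x)$ is the coefficient of $y^d$ in $\Phi(x,y)$. A connected component of $G(\Phi)$ is singular if it has a loop, a multiple arc or a defective vertex; $G(\Phi)^*$ is obtained from $G(\Phi)$ by removing the singular components. Let $H=([n],E)$ be a finite, connected, $d$-regular simple graph (regarded as a digraph with one arc in each direction for each edge). $H$ is strongly $\Phi$-polynomial if every connected component of $G(\Phi)^*$ is isomorphic to $H$. Let $$W(H,\Phi)=\{(u_1,\ldots,u_n)\in\mathbb{C}^n : \Phi(u_i,u_j)=0 \text{ for all } ij\in E\},$$ call a point $(u_1,\dots,u_n)\in\mathbb{C}^n$ improper if $u_i=u_j$ for some $i\neq j$, let $Z(H,\Phi)$ be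 the set of improper points of $W(H,\Phi)$, and let $U(H,\Phi)$ be the Zariski closure of $W(H,\Phi)\setminus Z(H,\Phi)$ in $\mathbb{C}^n$. Suppose that $H$ is strongly $\Phi$-polynomial and that $C$ is a singular component of $G(\Phi)$ without defective vertices. Then there exists an improper point $(u_1,\ldots,u_n)\in U(H,\Phi)$ such that $C=\langle u_1,\ldots,u_n\rangle$, the subdigraph of $G(\Phi)$ induced by $u_1,\ldots,u_n$. Moreover, there exists a morphism of digraphs from $H$ onto $C$, surjective on vertices and on arcs (counted with multiplicity). -/

import Mathlib

/-! ### Digraphs with multiplicities -/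

/-- A digraph, loops and multiple arcs allowed, with vertex set `verts` inside an ambient type `V`.
`mult u v` is the number of arcs from `u` to `v`. -/
@[ext]
structure MultiDigraph (V : Type*) where
  verts : Set V
  mult : V → V → ℕ∞
  left_mem : ∀ u v, mult u v ≠ 0 → u ∈ verts
  right_mem : ∀ u v, mult u v ≠ 0 → v ∈ verts

namespace MultiDigraph

/-- There is at least one arc from `u` to `v`. -/
def Adj {V : Type*} (G : MultiDigraph V) (u v : V) : Prop := G.mult u v ≠ 0

/-- The subdigraph of `G` induced by a set of vertices. -/
noncomputable def induce {V : Type*} (G : MultiDigraph V) (s : Set V) : MultiDigraph V where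
  verts := G.verts ∩ s
  mult u v := open Classical in if u ∈ s ∧ v ∈ s then G.mult u v else 0
  left_mem u v h := by
    by_cases hs : u ∈ s ∧ v ∈ s
    · rw [if_pos hs] at h
      exact ⟨G.left_mem u v h, hs.1⟩
    · exact absurd (if_neg hs) h
  right_mem u v h := by
    by_cases hs : u ∈ s ∧ v ∈ s
    · rw [if_pos hs] at h
      exact ⟨G.right_mem u v h, hs.2⟩
    · exact absurd (if_neg hs) h

/-- The connected component of `G` that contains `u`: the subdigraph induced by all vertices that
can be joined to `u` by a path, the direction of the arcs being ignored. -/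
noncomputable def componentOf {V : Type*} (G : MultiDigraph V) (u : V) : MultiDigraph V :=
  G.induce {v | Relation.EqvGen G.Adj u v}

/-- `C` is a connected component of `G`. -/
def IsComponent {V : Type*} (G C : MultiDigraph V) : Prop :=
  ∃ u ∈ G.verts, C = G.componentOf u

/-- An isomorphism of digraphs: a bijection on the vertices that preserves the number of arcs. -/
structure Iso {V W : Type*} (G : MultiDigraph V) (G' : MultiDigraph W) where
  toEquiv : G.verts ≃ G'.verts
  mult_eq : ∀ u v : G.verts, G'.mult (toEquiv u) (toEquiv v) = G.mult u v

/-- The arcs of `G`: the arcs from `u` to `v` are the triples `(u, v, k)` with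
`k < G.mult u v`. -/
def Arc {V : Type*} (G : MultiDigraph V) : Type _ :=
  {e : V × V × ℕ // (e.2.2 : ℕ∞) < G.mult e.1 e.2.1}

/-- The initial vertex of an arc. -/
def Arc.src {V : Type*} {G : MultiDigraph V} (e : G.Arc) : G.verts :=
  ⟨e.1.1, G.left_mem e.1.1 e.1.2.1 (pos_of_gt e.2).ne'⟩

/-- The final vertex of an arc. -/
def Arc.tgt {V : Type*} {G : MultiDigraph V} (e : G.Arc) : G.verts :=
  ⟨e.1.2.1, G.right_mem e.1.1 e.1.2.1 (pos_of_gt e.2).ne'⟩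

/-- A morphism of digraphs: a map on the vertices and a map on the arcs that are compatible with
the incidence. -/
structure Hom {V W : Type*} (G : MultiDigraph V) (G' : MultiDigraph W) where
  onVerts : G.verts → G'.verts
  onArcs : G.Arc → G'.Arc
  src_eq : ∀ e, (onArcs e).src = onVerts e.src
  tgt_eq : ∀ e, (onArcs e).tgt = onVerts e.tgt

/-- A morphism that is onto: every vertex and every arc of the target is an image. -/
def Hom.IsSurjective {V W : Type*} {G : MultiDigraph V} {G' : MultiDigraph W}
    (f : G.Hom G') : Prop :=
  Function.Surjective f.onVerts ∧ Function.Surjective f.onArcs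

/-- A simple graph, seen as a digraph: each edge `ij` gives one arc from `i` to `j` and one arc
from `j` to `i`. -/
noncomputable def ofSimpleGraph {V : Type*} (H : SimpleGraph V) : MultiDigraph V where
  verts := Set.univ
  mult i j := open Classical in if H.Adj i j then 1 else 0
  left_mem _ _ _ := Set.mem_univ _
  right_mem _ _ _ := Set.mem_univ _

end MultiDigraph

/-! ### The digraph of a polynomial

A polynomial `Φ(x, y)` with complex coefficients is an element of `ℂ[x][y]`, that is of
`Polynomial (Polynomial ℂ)`, where `y` is the outer variable. -/

namespace PolyGraph

/-- The polynomial `Φ(u, y)` in the variable `y`. -/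
noncomputable def fiber (Φ : Polynomial (Polynomial ℂ)) (u : ℂ) : Polynomial ℂ :=
  Φ.map (Polynomial.evalRingHom u)

/-- The digraph `G(Φ)`: the vertices are the complex numbers, and the number of arcs from `u` to `v`
is the multiplicity of `v` as a root of `Φ(u, y)` (infinite if `Φ(u, y)` is the zero polynomial). -/
noncomputable def graph (Φ : Polynomial (Polynomial ℂ)) : MultiDigraph ℂ where
  verts := Set.univ
  mult u v := emultiplicity (Polynomial.X - Polynomial.C v) (fiber Φ u)
  left_mem _ _ _ := Set.mem_univ _
  right_mem _ _ _ := Set.mem_univ _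

/-- There is an arc from `u` to `v` exactly if `Φ(u, v) = 0`. -/
theorem graph_adj_iff (Φ : Polynomial (Polynomial ℂ)) (u v : ℂ) :
    (graph Φ).Adj u v ↔ Φ.evalEval u v = 0 := by
  have h : (fiber Φ u).eval v = Φ.evalEval u v := by
    rw [fiber, Polynomial.map_evalRingHom_eval]
  rw [← h]
  change emultiplicity _ _ ≠ 0 ↔ _
  rw [Ne, emultiplicity_eq_zero, not_not, Polynomial.dvd_iff_isRoot, Polynomial.IsRoot.def]

/-- `Φ(x, y)` is symmetric: `Φ(y, x) = Φ(x, y)`. -/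
def IsSymmetric (Φ : Polynomial (Polynomial ℂ)) : Prop :=
  Polynomial.Bivariate.swap Φ = Φ

/-- `Φ(x, y)` is standard: it has no repeated factor, no nonconstant factor that depends on `x` only
or on `y` only, and `Φ(x, x)` is not the zero polynomial. -/
structure IsStandard (Φ : Polynomial (Polynomial ℂ)) : Prop where
  squarefree : Squarefree Φ
  no_factor_x : ∀ f : Polynomial ℂ, Polynomial.C f ∣ Φ → f.natDegree = 0
  no_factor_y : ∀ f : Polynomial ℂ, f.map Polynomial.C ∣ Φ → f.natDegree = 0
  diag_ne_zero : Φ.eval Polynomial.X ≠ 0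

/-- A vertex `u` is defective if `a_d(u) = 0`, where `a_d(x)` is the coefficient of `y ^ d` in
`Φ(x, y)` and `d` is the degree in `y`: so `Φ(u, y)` has fewer than `d` roots, with multiplicity,
or is zero. -/
def IsDefective (Φ : Polynomial (Polynomial ℂ)) (u : ℂ) : Prop :=
  Φ.leadingCoeff.eval u = 0

/-- A component `C` of `G(Φ)` is singular if it has a loop, a multiple arc or a defective vertex. -/
def IsSingular (Φ : Polynomial (Polynomial ℂ)) (C : MultiDigraph ℂ) : Prop :=
  (∃ u, C.Adj u u) ∨ (∃ u v, 2 ≤ C.mult u v) ∨ ∃ u ∈ C.verts, IsDefective Φ u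

/-- The digraph `G(Φ)*`, obtained from `G(Φ)` by removing the singular components. -/
noncomputable def graphStar (Φ : Polynomial (Polynomial ℂ)) : MultiDigraph ℂ :=
  (graph Φ).induce {u | ¬ IsSingular Φ ((graph Φ).componentOf u)}

/-- `(H, Φ)` is a `d`-pairing: `H` is a finite connected `d`-regular graph on `n` vertices, `d ≥ 1`,
and `Φ` is a symmetric polynomial of partial degree `d`. -/
structure IsPairing {n : ℕ} (d : ℕ) (H : SimpleGraph (Fin n))
    (Φ : Polynomial (Polynomial ℂ)) : Prop where
  one_le : 1 ≤ d
  connected : H.Connected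
  regular : ∀ i, (H.neighborSet i).ncard = d
  symmetric : IsSymmetric Φ
  degree_eq : Φ.natDegree = d

/-- `H` is strongly `Φ`-polynomial: `(H, Φ)` is a standard pairing and all components of `G(Φ)*` are
isomorphic to `H`. -/
structure IsStronglyPolynomial {n : ℕ} (H : SimpleGraph (Fin n))
    (Φ : Polynomial (Polynomial ℂ)) : Prop where
  pairing : ∃ d, IsPairing d H Φ
  standard : IsStandard Φ
  iso : ∀ C, (graphStar Φ).IsComponent C →
    Nonempty ((MultiDigraph.ofSimpleGraph H).Iso C)

/-- The system `S(H, Φ)` of the polynomials `Φ(x_i, x_j)`, `ij` an edge of `H`. -/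
def system {n : ℕ} (H : SimpleGraph (Fin n)) (Φ : Polynomial (Polynomial ℂ)) :
    Set (MvPolynomial (Fin n) ℂ) :=
  {p | ∃ i j, H.Adj i j ∧
    p = Polynomial.aevalAeval (MvPolynomial.X i) (MvPolynomial.X j) Φ}

/-- The variety `W(H, Φ)` of the system. -/
def varietyW {n : ℕ} (H : SimpleGraph (Fin n)) (Φ : Polynomial (Polynomial ℂ)) :
    Set (Fin n → ℂ) :=
  {u | ∀ p ∈ system H Φ, MvPolynomial.eval u p = 0}

/-- A point of `W(H, Φ)` is the same as a labelling of the vertices of `H` by complex numbers that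
maps edges of `H` to zeros of `Φ`. -/
theorem mem_varietyW_iff {n : ℕ} (H : SimpleGraph (Fin n)) (Φ : Polynomial (Polynomial ℂ))
    (u : Fin n → ℂ) :
    u ∈ varietyW H Φ ↔ ∀ i j, H.Adj i j → Φ.evalEval (u i) (u j) = 0 := by
  have key : ∀ i j, MvPolynomial.eval u
      (Polynomial.aevalAeval (MvPolynomial.X i) (MvPolynomial.X j) Φ)
      = Φ.evalEval (u i) (u j) := by
    intro i j
    have h : (MvPolynomial.aeval u).comp (Polynomial.aevalAeval (R := ℂ)
        (MvPolynomial.X i : MvPolynomial (Fin n) ℂ) (MvPolynomial.X j))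
        = Polynomial.aevalAeval (u i) (u j) := by
      ext <;> simp
    have h2 := DFunLike.congr_fun h Φ
    rw [← Polynomial.coe_aevalAeval_eq_evalEval, ← h2]
    simp [MvPolynomial.aeval_eq_eval]
  constructor
  · intro h i j hij
    rw [← key]
    exact h _ ⟨i, j, hij, rfl⟩
  · rintro h p ⟨i, j, hij, rfl⟩
    rw [key]
    exact h i j hij

/-- The set of points with two equal coordinates, the union of the hyperplanes `x_i = x_j`. -/
def diagonals (n : ℕ) : Set (Fin n → ℂ) := {u | ∃ i j, i < j ∧ u i = u j}

/-- A point is improper if two of its coordinates are equal. -/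
def IsImproper {n : ℕ} (u : Fin n → ℂ) : Prop := u ∈ diagonals n

/-- The set `Z(H, Φ)` of the improper points of `W(H, Φ)`. -/
def varietyZ {n : ℕ} (H : SimpleGraph (Fin n)) (Φ : Polynomial (Polynomial ℂ)) :
    Set (Fin n → ℂ) :=
  varietyW H Φ ∩ diagonals n

/-- The Zariski closure in affine space: the common zeros of all polynomials that vanish on `s`. -/
def zariskiClosure {n : ℕ} (s : Set (Fin n → ℂ)) : Set (Fin n → ℂ) :=
  MvPolynomial.zeroLocus ℂ (MvPolynomial.vanishingIdeal ℂ s)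

/-- The variety `U(H, Φ)`, the Zariski closure of the set of proper points of `W(H, Φ)`. -/
def varietyU {n : ℕ} (H : SimpleGraph (Fin n)) (Φ : Polynomial (Polynomial ℂ)) :
    Set (Fin n → ℂ) :=
  zariskiClosure (varietyW H Φ \ varietyZ H Φ)

end PolyGraph

/-! The component `C` is a limit of copies of `H`. Singular components are countably many countable
sets (`countable_setOf_isSingular`), so a vertex `c` of `C` is a limit of vertices `z` in
nonsingular components. Each of these is a copy of `H`, that is, an injective labelling `w z` of `H`
having `z` among its labels and satisfying `IsCovering`: the neighbours of `i` carry exactly the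
roots of `Φ(w i, y)`, with multiplicity (`IsStronglyPolynomial.exists_isCovering`).

Since `C` has no defective vertex, roots stay bounded near it. As `H` is connected, convergence of
one label to `c` forces convergence of all along an ultrafilter (`exists_tendsto_of_isCovering`).
The covering identity is closed and passes to the limit `u`, whereas injectivity may be lost.

The limit lies in `U(H, Φ)` because polynomials are continuous. Counting roots shows that its labels
fill `C` and that `H` maps onto `C`, arcs included. An injective `u` would make `C` nonsingular, so
`u` is improper. -/

open Polynomial

/-! ### Squarefree polynomials and their derivatives -/

/-- A squarefree primitive polynomial stays squarefree over the field of fractions. -/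
theorem Polynomial.IsPrimitive.squarefree_map_fraction {R K : Type*} [CommRing R] [IsDomain R]
    [NormalizedGCDMonoid R] [Field K] [Algebra R K] [IsFractionRing R K] {p : R[X]}
    (hp : p.IsPrimitive) (hsq : Squarefree p) : Squarefree (p.map (algebraMap R K)) := by
  intro q hq
  have hp0 : p.map (algebraMap R K) ≠ 0 :=
    (Polynomial.map_ne_zero_iff (IsFractionRing.injective R K)).2 hp.ne_zero
  have hq0 : q ≠ 0 := by
    rintro rfl
    exact hp0 (by simpa using hq)
  set s := (IsLocalization.integerNormalization (nonZeroDivisors R) q).primPart with hs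
  refine isUnit_or_eq_zero_of_isUnit_integerNormalization_primPart (R := R) hq0 ?_
  rw [← hs]
  apply hsq
  -- Gauss's lemma: `s * s` is primitive, so its divisibility of `p` can be checked over `K`.
  have hsp : (s * s).IsPrimitive := (isPrimitive_primPart _).mul (isPrimitive_primPart _)
  refine hsp.dvd_of_fraction_map_dvd_fraction_map (K := K) ?_
  have hsq' : s.map (algebraMap R K) ∣ q := by
    obtain ⟨b, hb, hbq⟩ := IsLocalization.integerNormalization_spec (nonZeroDivisors R) q
    have h1 : s.map (algebraMap R K) ∣ b • q := by
      rw [← hbq]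
      exact Polynomial.map_dvd _ (primPart_dvd _)
    have hb0 : algebraMap R K b ≠ 0 := by
      simpa using nonZeroDivisors.ne_zero hb
    have h2 : b • q = C (algebraMap R K b) * q := by
      rw [← smul_eq_C_mul, algebraMap_smul]
    rw [h2] at h1
    exact (IsUnit.dvd_mul_left (Polynomial.isUnit_C.2 hb0.isUnit)).1 h1
  rw [Polynomial.map_mul]
  exact (mul_dvd_mul hsq' hsq').trans hq

/-- A squarefree primitive polynomial over a domain of characteristic zero and its derivative
generate an ideal that contains a nonzero constant. -/
theorem Polynomial.IsPrimitive.exists_combination_derivative {R : Type*} [CommRing R] [IsDomain R]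
    [NormalizedGCDMonoid R] [CharZero R] {p : R[X]} (hp : p.IsPrimitive) (hsq : Squarefree p) :
    ∃ (a b : R[X]) (r : R), r ≠ 0 ∧ a * p + b * derivative p = C r := by
  let K := FractionRing R
  have hinj : Function.Injective (algebraMap R K) := IsFractionRing.injective R K
  have : CharZero K := charZero_of_injective_algebraMap hinj
  obtain ⟨a, b, hab⟩ :=
    PerfectField.separable_iff_squarefree.2 (hp.squarefree_map_fraction (K := K) hsq)
  obtain ⟨r, hr, har⟩ := IsLocalization.integerNormalization_spec (nonZeroDivisors R) a
  obtain ⟨s, hs, hbs⟩ := IsLocalization.integerNormalization_spec (nonZeroDivisors R) b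
  -- Here `r` and `s` are denominators of the Bézout coefficients `a` and `b` over `K`; the relation
  -- is multiplied by `r * s`.
  refine ⟨C s * IsLocalization.integerNormalization (nonZeroDivisors R) a,
    C r * IsLocalization.integerNormalization (nonZeroDivisors R) b, r * s,
    mul_ne_zero (nonZeroDivisors.ne_zero hr) (nonZeroDivisors.ne_zero hs), ?_⟩
  apply Polynomial.map_injective _ hinj
  rw [Polynomial.derivative_map] at hab
  simp only [Polynomial.map_add, Polynomial.map_mul, har, hbs, map_C, map_mul]
  rw [← algebraMap_smul K r a, ← algebraMap_smul K s b, smul_eq_C_mul, smul_eq_C_mul]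
  linear_combination (C (algebraMap R K r) * C (algebraMap R K s)) * hab

/-! ### Finiteness of the exceptional vertices of a standard polynomial -/

namespace PolyGraph

theorem IsStandard.ne_zero {Φ : Polynomial (Polynomial ℂ)} (h : IsStandard Φ) : Φ ≠ 0 := by
  rintro rfl
  exact h.diag_ne_zero (by simp)

theorem IsStandard.isPrimitive {Φ : Polynomial (Polynomial ℂ)} (h : IsStandard Φ) :
    Φ.IsPrimitive := by
  intro f hf
  have hf0 : f ≠ 0 := by
    rintro rfl
    exact h.ne_zero (by simpa using hf)
  rw [Polynomial.isUnit_iff_degree_eq_zero, Polynomial.degree_eq_natDegree hf0, h.no_factor_x f hf]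
  rfl

theorem fiber_coeff (Φ : Polynomial (Polynomial ℂ)) (u : ℂ) (k : ℕ) :
    (fiber Φ u).coeff k = (Φ.coeff k).eval u := by
  simp [fiber]

theorem fiber_eval (Φ : Polynomial (Polynomial ℂ)) (u v : ℂ) :
    (fiber Φ u).eval v = Φ.evalEval u v := by
  rw [fiber, Polynomial.map_evalRingHom_eval]

theorem IsStandard.fiber_ne_zero {Φ : Polynomial (Polynomial ℂ)} (h : IsStandard Φ) (u : ℂ) :
    fiber Φ u ≠ 0 := by
  intro h0
  have : C (X - C u) ∣ Φ := by
    rw [Polynomial.C_dvd_iff_dvd_coeff]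
    intro k
    rw [Polynomial.dvd_iff_isRoot, Polynomial.IsRoot.def, ← fiber_coeff, h0, coeff_zero]
  simpa using h.no_factor_x _ this

theorem IsSymmetric.evalEval_comm {Φ : Polynomial (Polynomial ℂ)} (h : IsSymmetric Φ) (u v : ℂ) :
    Φ.evalEval u v = Φ.evalEval v u := by
  have := Polynomial.Bivariate.aevalAeval_swap u v Φ
  rw [h] at this
  simpa only [Polynomial.coe_aevalAeval_eq_evalEval] using this

theorem IsSymmetric.adj_symm {Φ : Polynomial (Polynomial ℂ)} (h : IsSymmetric Φ) {u v : ℂ}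
    (huv : (graph Φ).Adj u v) : (graph Φ).Adj v u := by
  rw [graph_adj_iff] at huv ⊢
  rwa [h.evalEval_comm]

theorem IsStandard.finite_setOf_adj {Φ : Polynomial (Polynomial ℂ)} (h : IsStandard Φ) (u : ℂ) :
    {v | (graph Φ).Adj u v}.Finite := by
  refine (Polynomial.finite_setOfPred_isRoot (h.fiber_ne_zero u)).subset fun v hv => ?_
  rw [Set.mem_ofPred_eq, graph_adj_iff, ← fiber_eval] at hv
  exact hv

theorem IsStandard.finite_setOf_loop {Φ : Polynomial (Polynomial ℂ)} (h : IsStandard Φ) :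
    {u | (graph Φ).Adj u u}.Finite := by
  refine (Polynomial.finite_setOfPred_isRoot h.diag_ne_zero).subset fun u hu => ?_
  rw [Set.mem_ofPred_eq, graph_adj_iff] at hu
  have : ((evalRingHom u).comp (evalRingHom X)) Φ = Polynomial.evalEvalRingHom u u Φ := by
    congr 1
    ext <;> simp
  simpa [hu] using this

/-- A multiple root of `Φ(u, y)` is a common zero of `Φ(u, y)` and its derivative in `y`. A
combination of these two is a nonzero polynomial `r` in `x` alone, so `r(u) = 0`. -/
theorem IsStandard.finite_setOf_multiple {Φ : Polynomial (Polynomial ℂ)} (h : IsStandard Φ) :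
    {u | ∃ v, 2 ≤ (graph Φ).mult u v}.Finite := by
  obtain ⟨a, b, r, hr, hab⟩ := h.isPrimitive.exists_combination_derivative h.squarefree
  refine (Polynomial.finite_setOfPred_isRoot hr).subset ?_
  rintro u ⟨v, hv⟩
  have hdvd : (X - C v) ^ 2 ∣ fiber Φ u := pow_dvd_of_le_emultiplicity hv
  have h1 : (fiber Φ u).eval v = 0 :=
    Polynomial.dvd_iff_isRoot.1 ((dvd_pow_self _ two_ne_zero).trans hdvd)
  have h2 : (derivative (fiber Φ u)).eval v = 0 := by
    obtain ⟨q, hq⟩ := hdvd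
    simp [hq, derivative_pow]
  have h3 := congrArg (fun p => (p.map (evalRingHom u)).eval v) hab
  rw [fiber, derivative_map] at h2
  rw [fiber] at h1
  simpa [h1, h2, eq_comm] using h3

theorem IsStandard.finite_setOf_isDefective {Φ : Polynomial (Polynomial ℂ)} (h : IsStandard Φ) :
    {u | IsDefective Φ u}.Finite :=
  Polynomial.finite_setOfPred_isRoot (Polynomial.leadingCoeff_ne_zero.2 h.ne_zero)

end PolyGraph

/-! ### Countability of the singular components -/

theorem Relation.EqvGen.reflTransGen {α : Type*} {r : α → α → Prop} [Std.Symm r] {a b : α}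
    (h : Relation.EqvGen r a b) :
    Relation.ReflTransGen r a b := by
  induction h with
  | rel _ _ h => exact .single h
  | refl _ => exact .refl
  | symm _ _ _ ih => exact Std.Symm.symm _ _ ih
  | trans _ _ _ _ _ h1 h2 => exact h1.trans h2

theorem Relation.countable_setOf_eqvGen {α : Type*} {r : α → α → Prop} (hr : ∀ {a b}, r a b → r b a)
    (hc : ∀ a, {b | r a b}.Countable) (a : α) : {b | Relation.EqvGen r a b}.Countable := by
  -- `S k` is the set of endpoints of walks of length `k` from `a`.
  let S : ℕ → Set α := fun k => Nat.rec {a} (fun _ s => ⋃ x ∈ s, {b | r x b}) k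
  have hS : ∀ k, (S k).Countable := by
    intro k
    induction k with
    | zero => exact Set.countable_singleton a
    | succ k ih => exact ih.biUnion fun x _ => hc x
  refine (Set.countable_iUnion hS).mono fun b hb => ?_
  have : Std.Symm r := ⟨fun _ _ => hr⟩
  have hb' : Relation.ReflTransGen r a b := hb.reflTransGen
  clear hb
  induction hb' with
  | refl => exact Set.mem_iUnion.2 ⟨0, rfl⟩
  | @tail x y hx hxy ih =>
    obtain ⟨k, hk⟩ := Set.mem_iUnion.1 (ih)
    exact Set.mem_iUnion.2 ⟨k + 1, Set.mem_biUnion hk hxy⟩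

namespace PolyGraph

/-- Every singular component contains one of finitely many exceptional vertices, and components are
countable because each vertex has finitely many neighbours. -/
theorem countable_setOf_isSingular {Φ : Polynomial (Polynomial ℂ)} (h : IsStandard Φ)
    (hs : IsSymmetric Φ) : {u | IsSingular Φ ((graph Φ).componentOf u)}.Countable := by
  have hB := ((h.finite_setOf_loop.union h.finite_setOf_multiple).union
    h.finite_setOf_isDefective).countable
  refine (hB.biUnion fun b _ => Relation.countable_setOf_eqvGen (r := (graph Φ).Adj)
    hs.adj_symm (fun a => (h.finite_setOf_adj a).countable) b).mono ?_
  have key : ∀ {u a b : ℂ}, ((graph Φ).componentOf u).mult a b ≠ 0 →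
      Relation.EqvGen (graph Φ).Adj a u ∧
        ((graph Φ).componentOf u).mult a b = (graph Φ).mult a b := by
    intro u a b hab
    have hc : Relation.EqvGen (graph Φ).Adj u a ∧ Relation.EqvGen (graph Φ).Adj u b := by
      by_contra hc
      exact hab (if_neg hc)
    exact ⟨hc.1.symm, if_pos hc⟩
  rintro u (⟨a, ha⟩ | ⟨a, b, hab⟩ | ⟨a, ha, hd⟩)
  · obtain ⟨h1, h2⟩ := key ha
    refine Set.mem_biUnion (x := a) (Or.inl (Or.inl ?_)) h1
    rw [MultiDigraph.Adj, h2] at ha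
    exact ha
  · obtain ⟨h1, h2⟩ := key (u := u) (a := a) (b := b) (by
      intro h0
      rw [h0] at hab
      exact absurd hab (by norm_num))
    exact Set.mem_biUnion (x := a) (Or.inl (Or.inr ⟨b, h2 ▸ hab⟩)) h1
  · exact Set.mem_biUnion (x := a) (Or.inr hd) ha.2.symm

end PolyGraph

/-! ### Coverings and their limits -/

namespace PolyGraph

open Filter Topology

open Classical in
/-- A labelling `w` of the vertices of `H` by complex numbers such that the roots of `Φ(w i, y)`,
with multiplicity, are the labels of the neighbours of `i`. -/
def IsCovering {n : ℕ} (H : SimpleGraph (Fin n)) (Φ : Polynomial (Polynomial ℂ))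
    (w : Fin n → ℂ) : Prop :=
  ∀ i, fiber Φ (w i) = C (Φ.leadingCoeff.eval (w i)) * ∏ j with H.Adj i j, (X - C (w j))

theorem IsCovering.evalEval_eq_zero {n : ℕ} {H : SimpleGraph (Fin n)}
    {Φ : Polynomial (Polynomial ℂ)} {w : Fin n → ℂ} (hw : IsCovering H Φ w) {i j : Fin n}
    (hij : H.Adj i j) : Φ.evalEval (w i) (w j) = 0 := by
  classical
  rw [← fiber_eval, hw i, eval_mul, eval_prod, Finset.prod_eq_zero (i := j), mul_zero]
  · simpa using hij
  · simp

open Classical in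
/-- The number of arcs from `w i` to `v` is the number of neighbours of `i` with label `v`. -/
theorem IsCovering.mult_eq {n : ℕ} {H : SimpleGraph (Fin n)}
    {Φ : Polynomial (Polynomial ℂ)} {w : Fin n → ℂ} (hw : IsCovering H Φ w) {i : Fin n}
    (hi : ¬ IsDefective Φ (w i)) (v : ℂ) :
    (graph Φ).mult (w i) v = ((Finset.univ.filter fun j => H.Adj i j ∧ w j = v).card : ℕ∞) := by
  change emultiplicity (X - C v) (fiber Φ (w i)) = _
  have hone : ∀ a : ℂ, emultiplicity (X - C v) (X - C a) = if a = v then 1 else 0 := by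
    intro a
    split_ifs with h
    · subst h
      exact (FiniteMultiplicity.of_prime_left (prime_X_sub_C a)
        (X_sub_C_ne_zero a)).emultiplicity_self
    · rw [emultiplicity_eq_zero, Polynomial.dvd_iff_isRoot]
      simpa [sub_eq_zero, eq_comm] using h
  have hunit : emultiplicity (X - C v) (C (Φ.leadingCoeff.eval (w i))) = 0 := by
    rw [emultiplicity_eq_zero, Polynomial.dvd_iff_isRoot]
    simpa [IsDefective] using hi
  rw [hw i, emultiplicity_mul (prime_X_sub_C v), hunit, zero_add,
    Finset.emultiplicity_prod (prime_X_sub_C v), Finset.sum_congr rfl fun j _ => hone (w j),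
    Finset.sum_boole, Finset.filter_filter]

theorem continuous_evalEval (Φ : Polynomial (Polynomial ℂ)) (v : ℂ) :
    Continuous fun u => Φ.evalEval u v := by
  have : (fun u => Φ.evalEval u v) = fun u => (Φ.eval (C v)).eval u := rfl
  rw [this]
  exact Polynomial.continuous _

/-- For each fixed `y`, both sides of the covering identity are continuous in the labels. -/
theorem IsCovering.of_tendsto {ι : Type*} {f : Filter ι} [f.NeBot] {n : ℕ}
    {H : SimpleGraph (Fin n)} {Φ : Polynomial (Polynomial ℂ)} {w : ι → Fin n → ℂ} {u : Fin n → ℂ}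
    (hw : ∀ᶠ z in f, IsCovering H Φ (w z)) (hu : Tendsto w f (𝓝 u)) : IsCovering H Φ u := by
  classical
  intro i
  refine Polynomial.funext fun y => ?_
  have hu' := tendsto_pi_nhds.1 hu
  have h1 : Tendsto (fun z => (fiber Φ (w z i)).eval y) f (𝓝 ((fiber Φ (u i)).eval y)) := by
    simp only [fiber_eval]
    exact ((continuous_evalEval Φ y).tendsto _).comp (hu' i)
  have h2 : Tendsto (fun z => (C (Φ.leadingCoeff.eval (w z i)) *
      ∏ j with H.Adj i j, (X - C (w z j))).eval y) f
      (𝓝 ((C (Φ.leadingCoeff.eval (u i)) * ∏ j with H.Adj i j, (X - C (u j))).eval y)) := by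
    simp only [eval_mul, eval_C, eval_prod, eval_sub, eval_X]
    exact ((Φ.leadingCoeff.continuous.tendsto _).comp (hu' i)).mul
      (tendsto_finsetProd _ fun j _ => tendsto_const_nhds.sub (hu' j))
  refine tendsto_nhds_unique h1 (h2.congr' ?_)
  filter_upwards [hw] with z hz
  rw [hz i]

/-- Roots of `Φ(a, y)` stay bounded as `a` tends to a vertex that is not defective. -/
theorem exists_tendsto_of_evalEval_eq_zero {ι : Type*} {f : Ultrafilter ι}
    {Φ : Polynomial (Polynomial ℂ)} {a b : ι → ℂ} {α : ℂ} (ha : Tendsto a f (𝓝 α))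
    (hα : ¬ IsDefective Φ α) (hab : ∀ᶠ z in f, Φ.evalEval (a z) (b z) = 0) :
    ∃ β, Tendsto b f (𝓝 β) ∧ Φ.evalEval α β = 0 := by
  have hlead : Tendsto (fun z => Φ.leadingCoeff.eval (a z)) f (𝓝 (Φ.leadingCoeff.eval α)) :=
    (Φ.leadingCoeff.continuous.tendsto _).comp ha
  -- `M` dominates the Cauchy bound on the roots; a sum in place of the maximum of the coefficients
  -- makes its continuity at `α` immediate. Near `α` the roots thus lie in one compact ball.
  let M : ℂ → ℝ := fun x =>
    (∑ k ∈ Finset.range Φ.natDegree, ‖(Φ.coeff k).eval x‖) / ‖Φ.leadingCoeff.eval x‖ + 1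
  have hM : Tendsto (fun z => M (a z)) f (𝓝 (M α)) := by
    refine (Tendsto.div (tendsto_finsetSum _ fun k _ => ?_) hlead.norm
      (norm_ne_zero_iff.2 hα)).add_const 1
    exact (((Φ.coeff k).continuous.tendsto _).comp ha).norm
  have hbound : ∀ᶠ z in f, b z ∈ Metric.closedBall (0 : ℂ) (M α + 1) := by
    filter_upwards [hM.eventually_lt_const (lt_add_one (M α)), hlead.eventually_ne hα, hab]
      with z h1 h2 h3
    rw [mem_closedBall_zero_iff]
    refine le_trans ?_ h1.le
    have hne : evalRingHom (a z) Φ.leadingCoeff ≠ 0 := h2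
    have hdeg : (fiber Φ (a z)).natDegree = Φ.natDegree :=
      natDegree_map_of_leadingCoeff_ne_zero _ hne
    have hlc : (fiber Φ (a z)).leadingCoeff = Φ.leadingCoeff.eval (a z) := by
      rw [leadingCoeff, hdeg, fiber_coeff, coeff_natDegree]
    have h0 : fiber Φ (a z) ≠ 0 := by
      rw [← leadingCoeff_ne_zero, hlc]
      exact h2
    have hroot : (fiber Φ (a z)).IsRoot (b z) := by
      rw [IsRoot.def, fiber_eval, h3]
    have hlt := hroot.norm_lt_cauchyBound h0
    have hle : cauchyBound (fiber Φ (a z)) ≤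
        (∑ k ∈ Finset.range Φ.natDegree, ‖(Φ.coeff k).eval (a z)‖₊) /
          ‖Φ.leadingCoeff.eval (a z)‖₊ + 1 := by
      rw [cauchyBound, hdeg, hlc]
      gcongr
      refine Finset.sup_le fun k hk => ?_
      rw [fiber_coeff]
      exact Finset.single_le_sum (f := fun k => ‖(Φ.coeff k).eval (a z)‖₊)
        (fun _ _ => zero_le) hk
    have hcast := NNReal.coe_le_coe.2 hle
    push_cast at hcast
    exact (NNReal.coe_le_coe.2 hlt.le).trans hcast
  obtain ⟨β, -, hβ⟩ := (isCompact_closedBall (0 : ℂ) (M α + 1)).ultrafilter_le_nhds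
    (f.map b) (Filter.le_principal_iff.2 hbound)
  have hb : Tendsto b f (𝓝 β) := hβ
  refine ⟨β, hb, ?_⟩
  have hcont : Continuous fun p : ℂ × ℂ => Φ.evalEval p.1 p.2 := by
    have : (fun p : ℂ × ℂ => Φ.evalEval p.1 p.2) = fun p : ℂ × ℂ =>
        ∑ k ∈ Finset.range (Φ.natDegree + 1), (Φ.coeff k).eval p.1 * p.2 ^ k := by
      funext p
      rw [evalEval, eval_eq_sum_range (p := Φ), eval_finsetSum]
      simp
    rw [this]
    exact continuous_finsetSum _ fun k _ =>
      ((Φ.coeff k).continuous.comp continuous_fst).mul (continuous_snd.pow k)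
  refine tendsto_nhds_unique ((hcont.tendsto (α, β)).comp (ha.prodMk_nhds hb))
    (tendsto_const_nhds.congr' ?_)
  filter_upwards [hab] with z hz using hz.symm

/-- A family of coverings converges along an ultrafilter as soon as one label converges to a vertex
whose component has no defective vertices. -/
theorem exists_tendsto_of_isCovering {ι : Type*} {f : Ultrafilter ι} {n : ℕ}
    {H : SimpleGraph (Fin n)} (hH : H.Connected) {Φ : Polynomial (Polynomial ℂ)}
    {w : ι → Fin n → ℂ} (hw : ∀ᶠ z in f, IsCovering H Φ (w z)) {i : Fin n} {c : ℂ}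
    (hc : Tendsto (fun z => w z i) f (𝓝 c))
    (hdef : ∀ v, Relation.EqvGen (graph Φ).Adj c v → ¬ IsDefective Φ v) :
    ∃ u, Tendsto w f (𝓝 u) := by
  -- The limits are built along a walk from `i`. Keeping each one in the component of `c` guarantees
  -- that it is not defective, which the next edge requires.
  have key : ∀ j, ∃ α, Tendsto (fun z => w z j) f (𝓝 α) ∧
      Relation.EqvGen (graph Φ).Adj c α := by
    intro j
    have hj := (SimpleGraph.reachable_iff_reflTransGen i j).1 (hH.preconnected i j)
    induction hj with
    | refl => exact ⟨c, hc, .refl _⟩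
    | @tail k l _ hkl ih =>
      obtain ⟨α, hα, hcα⟩ := ih
      obtain ⟨β, hβ, hαβ⟩ := exists_tendsto_of_evalEval_eq_zero (b := fun z => w z l) hα
        (hdef α hcα) (hw.mono fun z hz => hz.evalEval_eq_zero hkl)
      exact ⟨β, hβ, hcα.trans _ _ _ (.rel _ _ ((graph_adj_iff Φ α β).2 hαβ))⟩
  choose u hu _ using key
  exact ⟨u, tendsto_pi_nhds.2 hu⟩

/-- The `d` neighbours of a vertex give `d` distinct roots of `Φ(w i, y)`, which has degree exactly
`d` as `w i` is not defective; there is no room for other roots. -/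
theorem IsStronglyPolynomial.exists_isCovering {n : ℕ} {H : SimpleGraph (Fin n)}
    {Φ : Polynomial (Polynomial ℂ)} (hH : IsStronglyPolynomial H Φ) {z : ℂ}
    (hz : ¬ IsSingular Φ ((graph Φ).componentOf z)) :
    ∃ w : Fin n → ℂ, Function.Injective w ∧ IsCovering H Φ w ∧ ∃ i, w i = z := by
  classical
  obtain ⟨d, hd⟩ := hH.pairing
  obtain ⟨φ⟩ := hH.iso _ ⟨z, ⟨Set.mem_univ z, hz⟩, rfl⟩
  let w : Fin n → ℂ := fun i => (φ.toEquiv ⟨i, Set.mem_univ i⟩ : ℂ)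
  have hinj : Function.Injective w := fun i j hij =>
    congrArg Subtype.val (φ.toEquiv.injective (Subtype.ext hij))
  have hmem : ∀ i, w i ∈ ((graphStar Φ).componentOf z).verts := fun i =>
    (φ.toEquiv ⟨i, Set.mem_univ i⟩).2
  have hns : ∀ i, ¬ IsSingular Φ ((graph Φ).componentOf (w i)) := fun i => (hmem i).1.2
  have hnd : ∀ i, ¬ IsDefective Φ (w i) := fun i hi =>
    hns i (Or.inr (Or.inr ⟨w i, ⟨Set.mem_univ _, .refl _⟩, hi⟩))
  have hmult : ∀ i j, (graph Φ).mult (w i) (w j) = if H.Adj i j then 1 else 0 := by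
    intro i j
    have h1 : ((graphStar Φ).componentOf z).mult (w i) (w j) = (graphStar Φ).mult (w i) (w j) :=
      if_pos ⟨(hmem i).2, (hmem j).2⟩
    have h2 : (graphStar Φ).mult (w i) (w j) = (graph Φ).mult (w i) (w j) :=
      if_pos ⟨hns i, hns j⟩
    rw [← h2, ← h1, φ.mult_eq ⟨i, Set.mem_univ i⟩ ⟨j, Set.mem_univ j⟩]
    simp only [MultiDigraph.ofSimpleGraph]
  refine ⟨w, hinj, fun i => ?_, ?_⟩
  · have hne : evalRingHom (w i) Φ.leadingCoeff ≠ 0 := hnd i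
    have hdeg : (fiber Φ (w i)).natDegree = d := by
      rw [fiber, natDegree_map_of_leadingCoeff_ne_zero _ hne, hd.degree_eq]
    have hlc : (fiber Φ (w i)).leadingCoeff = Φ.leadingCoeff.eval (w i) := by
      rw [leadingCoeff, hdeg, fiber_coeff, ← hd.degree_eq, coeff_natDegree]
    have hmonic : (∏ j with H.Adj i j, (X - C (w j))).Monic :=
      monic_prod_of_monic _ _ fun j _ => monic_X_sub_C _
    have hdvd : (∏ j with H.Adj i j, (X - C (w j))) ∣ fiber Φ (w i) := by
      refine Finset.prod_dvd_of_coprime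
        (fun j _ k _ hjk => pairwise_coprime_X_sub_C hinj hjk) fun j hj => ?_
      have hij : H.Adj i j := by simpa using hj
      rw [dvd_iff_isRoot, IsRoot.def, fiber_eval, ← graph_adj_iff, MultiDigraph.Adj, hmult,
        if_pos hij]
      exact one_ne_zero
    have hcard : (Finset.univ.filter fun j => H.Adj i j).card = d := by
      rw [← hd.regular i, ← Set.ncard_coe_finset]
      congr 1
      ext j
      simp
    rw [← hlc]
    refine eq_leadingCoeff_mul_of_monic_of_dvd_of_natDegree_le hmonic hdvd ?_
    rw [hdeg, natDegree_prod_of_monic _ _ fun j _ => monic_X_sub_C _]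
    simp [hcard]
  · obtain ⟨i, hi⟩ := φ.toEquiv.surjective ⟨z, ⟨Set.mem_univ z, hz⟩, .refl _⟩
    exact ⟨i.1, congrArg Subtype.val hi⟩

theorem mem_zariskiClosure_of_tendsto {ι : Type*} {f : Filter ι} [f.NeBot] {n : ℕ}
    {s : Set (Fin n → ℂ)} {w : ι → Fin n → ℂ} {u : Fin n → ℂ} (hw : ∀ᶠ z in f, w z ∈ s)
    (hu : Tendsto w f (𝓝 u)) : u ∈ zariskiClosure s := by
  rw [zariskiClosure, MvPolynomial.mem_zeroLocus_iff]
  intro p hp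
  rw [MvPolynomial.mem_vanishingIdeal_iff] at hp
  simp only [MvPolynomial.aeval_eq_eval] at hp ⊢
  refine tendsto_nhds_unique ((p.continuous_eval.tendsto u).comp hu)
    (tendsto_const_nhds.congr' ?_)
  filter_upwards [hw] with z hz using (hp _ hz).symm

/-! ### The image of a covering -/

/-- The labels of a covering without defective vertices form a component. -/
theorem IsCovering.range_eq {n : ℕ} {H : SimpleGraph (Fin n)} (hH : H.Connected)
    {Φ : Polynomial (Polynomial ℂ)} (hs : IsSymmetric Φ) {u : Fin n → ℂ} (hu : IsCovering H Φ u)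
    (i : Fin n) (hdef : ∀ v, Relation.EqvGen (graph Φ).Adj (u i) v → ¬ IsDefective Φ v) :
    Set.range u = {v | Relation.EqvGen (graph Φ).Adj (u i) v} := by
  classical
  have hsub : ∀ j, Relation.EqvGen (graph Φ).Adj (u i) (u j) := by
    intro j
    have hj := (SimpleGraph.reachable_iff_reflTransGen i j).1 (hH.preconnected i j)
    induction hj with
    | refl => exact .refl _
    | @tail k l _ hkl ih =>
      exact ih.trans _ _ _ (.rel _ _ ((graph_adj_iff Φ _ _).2 (hu.evalEval_eq_zero hkl)))
  -- An arc from `u k` to `b` has positive multiplicity, and this counts the neighbours of `k` with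
  -- label `b`, so one exists.
  have hclosed : ∀ {a b}, (graph Φ).Adj a b → a ∈ Set.range u → b ∈ Set.range u := by
    rintro _ b hab ⟨k, rfl⟩
    rw [MultiDigraph.Adj, hu.mult_eq (hdef _ (hsub k))] at hab
    obtain ⟨l, hl⟩ := Finset.card_ne_zero.1 (fun h => hab (by rw [h]; rfl))
    exact ⟨l, (Finset.mem_filter.1 hl).2.2⟩
  have hiff : ∀ {a b}, Relation.EqvGen (graph Φ).Adj a b →
      (a ∈ Set.range u ↔ b ∈ Set.range u) := by
    intro a b hab
    induction hab with
    | rel _ _ h => exact ⟨hclosed h, hclosed (hs.adj_symm h)⟩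
    | refl _ => exact Iff.rfl
    | symm _ _ _ ih => exact ih.symm
    | trans _ _ _ _ _ h1 h2 => exact h1.trans h2
  ext v
  refine ⟨?_, fun hv => (hiff hv).1 ⟨i, rfl⟩⟩
  rintro ⟨j, rfl⟩
  exact hsub j

/-- A covering without defective vertices is a morphism onto the digraph induced by its labels. -/
theorem IsCovering.exists_hom {n : ℕ} {H : SimpleGraph (Fin n)} {Φ : Polynomial (Polynomial ℂ)}
    {u : Fin n → ℂ} (hu : IsCovering H Φ u) (hdef : ∀ i, ¬ IsDefective Φ (u i)) :
    ∃ f : (MultiDigraph.ofSimpleGraph H).Hom ((graph Φ).induce (Set.range u)),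
      f.IsSurjective := by
  classical
  let N : Fin n → ℂ → Finset (Fin n) := fun i v => Finset.univ.filter fun j => H.Adj i j ∧ u j = v
  have hmult : ∀ i j, ((graph Φ).induce (Set.range u)).mult (u i) (u j) = (N i (u j)).card :=
    fun i j => (if_pos ⟨⟨i, rfl⟩, ⟨j, rfl⟩⟩).trans (hu.mult_eq (hdef i) (u j))
  -- The arcs from `u i` to `v` are as many as the elements of `N i v`. Numbering these elements
  -- matches each edge `ij` with one arc from `u i` to `u j`; the value 0 is never used on edges.
  let r : Fin n → Fin n → ℕ := fun i j =>
    if h : j ∈ N i (u j) then (N i (u j)).equivFin ⟨j, h⟩ else 0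
  have hadj : ∀ e : (MultiDigraph.ofSimpleGraph H).Arc, H.Adj e.1.1 e.1.2.1 := by
    intro e
    by_contra h
    have he : (e.1.2.2 : ℕ∞) < if H.Adj e.1.1 e.1.2.1 then 1 else 0 := e.2
    rw [if_neg h] at he
    exact not_lt_zero he
  have hr : ∀ i j, H.Adj i j → r i j < (N i (u j)).card := by
    intro i j hij
    have h : j ∈ N i (u j) := by simp [N, hij]
    simp only [r, dif_pos h]
    exact Fin.is_lt _
  refine ⟨⟨fun i => ⟨u i.1, Set.mem_univ _, ⟨i.1, rfl⟩⟩,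
    fun e => ⟨(u e.1.1, u e.1.2.1, r e.1.1 e.1.2.1), ?_⟩, fun e => rfl, fun e => rfl⟩, ?_, ?_⟩
  · rw [hmult]
    exact_mod_cast hr _ _ (hadj e)
  · rintro ⟨_, _, ⟨i, rfl⟩⟩
    exact ⟨⟨i, Set.mem_univ i⟩, rfl⟩
  · rintro ⟨⟨a, b, k⟩, he⟩
    have hab : a ∈ Set.range u ∧ b ∈ Set.range u := by
      have h0 := (pos_of_gt he).ne'
      exact ⟨(MultiDigraph.left_mem _ _ _ h0).2, (MultiDigraph.right_mem _ _ _ h0).2⟩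
    obtain ⟨⟨i, rfl⟩, ⟨j₀, rfl⟩⟩ := hab
    have hk : k < (N i (u j₀)).card := by
      have := he
      simp only [hmult] at this
      exact_mod_cast this
    obtain ⟨j, hij, huj, hrk⟩ : ∃ j, H.Adj i j ∧ u j = u j₀ ∧ r i j = k := by
      -- Freeing `v` from `j₀` allows it to be replaced by `u j` for the neighbour `j` of rank `k`.
      generalize u j₀ = v at hk
      obtain ⟨⟨j, hj⟩, hjk⟩ := (N i v).equivFin.surjective ⟨k, hk⟩
      obtain ⟨hij, rfl⟩ := (Finset.mem_filter.1 hj).2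
      refine ⟨j, hij, rfl, ?_⟩
      simp only [r, dif_pos hj, hjk]
    refine ⟨⟨(i, j, 0), ?_⟩, ?_⟩
    · change ((0 : ℕ) : ℕ∞) < if H.Adj i j then 1 else 0
      rw [if_pos hij]
      exact_mod_cast one_pos
    · apply Subtype.ext
      change (u i, u j, r i j) = (u i, u j₀, k)
      rw [hrk, huj]

/-- The labels of an injective covering without defective vertices induce a simple digraph. -/
theorem IsCovering.not_isSingular {n : ℕ} {H : SimpleGraph (Fin n)}
    {Φ : Polynomial (Polynomial ℂ)} {u : Fin n → ℂ} (hu : IsCovering H Φ u)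
    (hdef : ∀ i, ¬ IsDefective Φ (u i)) (hinj : Function.Injective u) :
    ¬ IsSingular Φ ((graph Φ).induce (Set.range u)) := by
  classical
  have hmult : ∀ {a b}, ((graph Φ).induce (Set.range u)).mult a b ≠ 0 → ∃ i j, u i = a ∧ u j = b ∧
      ((graph Φ).induce (Set.range u)).mult a b = if H.Adj i j then 1 else 0 := by
    intro a b h
    obtain ⟨⟨-, i, rfl⟩, ⟨-, j, rfl⟩⟩ :=
      And.intro (MultiDigraph.left_mem _ _ _ h) (MultiDigraph.right_mem _ _ _ h)
    refine ⟨i, j, rfl, rfl,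
      (if_pos ⟨⟨i, rfl⟩, ⟨j, rfl⟩⟩).trans ((hu.mult_eq (hdef i) (u j)).trans ?_)⟩
    -- By injectivity only `j` itself can carry the label `u j`, so the count is 1 or 0.
    simp only [hinj.eq_iff]
    rw [← Finset.filter_filter, Finset.filter_eq']
    split_ifs <;> simp_all
  rintro (⟨a, ha⟩ | ⟨a, b, hab⟩ | ⟨_, ⟨-, i, rfl⟩, hd⟩)
  · obtain ⟨i, j, hi, hj, h⟩ := hmult ha
    obtain rfl := hinj (hi.trans hj.symm)
    rw [if_neg H.irrefl] at h
    exact ha h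
  · obtain ⟨i, j, -, -, h⟩ := hmult (a := a) (b := b) (fun h0 => by
      rw [h0] at hab
      exact absurd hab (by norm_num))
    rw [h] at hab
    split_ifs at hab
    · exact absurd hab (by norm_num)
    · exact absurd hab (by norm_num)
  · exact hdef i hd

end PolyGraph

/-! ### The limit argument -/

theorem mainTheorem12 {n : ℕ} (H : SimpleGraph (Fin n)) (Φ : Polynomial (Polynomial ℂ))
    (hH : PolyGraph.IsStronglyPolynomial H Φ)
    (C : MultiDigraph ℂ) (hC : (PolyGraph.graph Φ).IsComponent C)
    (hsing : PolyGraph.IsSingular Φ C)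
    (hdef : ∀ u ∈ C.verts, ¬ PolyGraph.IsDefective Φ u) :
    (∃ u : Fin n → ℂ, u ∈ PolyGraph.varietyU H Φ ∧ PolyGraph.IsImproper u ∧
      C = (PolyGraph.graph Φ).induce (Set.range u)) ∧
    ∃ f : (MultiDigraph.ofSimpleGraph H).Hom C, f.IsSurjective := by
  classical
  obtain ⟨d, hd⟩ := hH.pairing
  obtain ⟨c, -, rfl⟩ := hC
  have hdef' : ∀ v, Relation.EqvGen (PolyGraph.graph Φ).Adj c v → ¬ PolyGraph.IsDefective Φ v :=
    fun v hv => hdef v ⟨Set.mem_univ v, hv⟩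
  have hdense : Dense {z | PolyGraph.IsSingular Φ ((PolyGraph.graph Φ).componentOf z)}ᶜ :=
    (PolyGraph.countable_setOf_isSingular hH.standard hd.symmetric).dense_compl ℂ
  have hne := mem_closure_iff_nhdsWithin_neBot.1 (hdense c)
  let f : Ultrafilter ℂ := Ultrafilter.of (nhdsWithin c
    {z | PolyGraph.IsSingular Φ ((PolyGraph.graph Φ).componentOf z)}ᶜ)
  have hf := Ultrafilter.of_le (nhdsWithin c
    {z | PolyGraph.IsSingular Φ ((PolyGraph.graph Φ).componentOf z)}ᶜ)
  have hfc : Filter.Tendsto id f (nhds c) := hf.trans nhdsWithin_le_nhds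
  have hex : ∀ᶠ z in f, ∃ w : Fin n → ℂ, Function.Injective w ∧ PolyGraph.IsCovering H Φ w ∧
      ∃ i, w i = z :=
    Filter.mem_of_superset (hf self_mem_nhdsWithin) fun z hz => hH.exists_isCovering hz
  obtain ⟨w, hw⟩ := hex.choice
  -- The position of `z` among the labels may depend on `z`, but there are finitely many positions
  -- and an ultrafilter selects one.
  obtain ⟨i, hi⟩ := Ultrafilter.eventually_exists_iff.1 (hw.mono fun z hz => hz.2.2)
  have hcov : ∀ᶠ z in f, PolyGraph.IsCovering H Φ (w z) := hw.mono fun z hz => hz.2.1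
  have hwi : Filter.Tendsto (fun z => w z i) f (nhds c) :=
    hfc.congr' (hi.mono fun z hz => hz.symm)
  obtain ⟨u, hu⟩ := PolyGraph.exists_tendsto_of_isCovering hd.connected hcov hwi hdef'
  have hucov := PolyGraph.IsCovering.of_tendsto hcov hu
  obtain rfl : u i = c := tendsto_nhds_unique (tendsto_pi_nhds.1 hu i) hwi
  have hrange := hucov.range_eq hd.connected hd.symmetric i hdef'
  have hCu : (PolyGraph.graph Φ).componentOf (u i) =
      (PolyGraph.graph Φ).induce (Set.range u) := by
    rw [hrange, MultiDigraph.componentOf]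
  have hnd : ∀ j, ¬ PolyGraph.IsDefective Φ (u j) := fun j =>
    hdef' _ (hrange.subset ⟨j, rfl⟩)
  rw [hCu] at hsing ⊢
  refine ⟨⟨u, ?_, ?_, rfl⟩, hucov.exists_hom hnd⟩
  · refine PolyGraph.mem_zariskiClosure_of_tendsto ?_ hu
    filter_upwards [hw] with z hz
    refine ⟨(PolyGraph.mem_varietyW_iff H Φ _).2 fun j k hjk => hz.2.1.evalEval_eq_zero hjk, ?_⟩
    rintro ⟨-, j, k, hjk, heq⟩
    exact hjk.ne (hz.1 heq)
  -- Were `u` proper, it would be an injective covering and `C` would not be singular.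
  · by_contra himp
    refine hucov.not_isSingular hnd (fun j k hjk => ?_) hsing
    by_contra hne
    rcases lt_or_gt_of_ne hne with hlt | hlt
    · exact himp ⟨j, k, hlt, hjk⟩
    · exact himp ⟨k, j, hlt, hjk.symm⟩
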